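/- Let $F:\mathbb R^3\to\mathbb R$, $(x,t,e)\mapsto F(x,t,e)$, be a $C^\infty$ function such that for all $(x,t,e)$: $F(-x,t,e)=-F(x,t,e)$, $F(x,-t,e)=F(x,t,e)$, $F(x,t+2\pi,e)=F(x,t,e)$, $F(x,t,0)=f(x)$ does not depend on $t$, and $xf(x)>0$ for $x\neq0$. Put $E(x)=\int_0^x f(u)\,du$ and, for $0<h<\sup_{\mathbb R}E$, let $T(h)$ be the minimal period of the (nonconstant, periodic) solutions of $\ddot x+f(x)=0$ on the energy level $\tfrac12\dot x^2+E(x)=h$. Let $m,p\ge1$ be integers and let $0<h_{m,p}<\sup_{\mathbb R} E$ satisfy $T(h_{m,p})=2m\pi/p$ and $T'(h_{m,p})\neq0$. Let $\phi_{m,p}(t,e)$, $0\le e<e_0$ (for some $e_0>0$), be the family of odd $2m\pi$-periodic solutions of $$\ddot x+F(x,t,e)=0 \qquad (1)$$ that emanates at $e=0$ from the odd solution of energy $h_{m,p}$. That is, there is a function $\eta\in C^\infty([0,e_0))$ with $\eta(0)=\sqrt{2h_{m,p}}$ such that, for every $e\in[0,e_0)$, $\phi_{m,p}(\cdot,e)$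 is the solution of (1) with $\phi_{m,p}(0,e)=0$ and $\dot\phi_{m,p}(0,e)=\eta(e)$, and $\phi_{m,p}(m\pi,e)=0$. (By the symmetries of $F$ such solutions are odd and $2m\pi$-periodic in $t$.) Let $\tau_{m,p}(e)=\psi_1(2m\pi,e)+\dot\psi_2(2m\pi,e)$ be the trace of the $2m\pi$-periodic Poincaré matrix of the linearization $$\ddot y+q(t,e)\,y=0,\qquad q(t,e)=\frac{\partial F}{\partial x}(\phi_{m,p}(t,e),t,e), \qquad (2)$$ where $\psi_1,\psi_2$ are the solutions of (2) with $(\psi_1,\dot\psi_1)(0)=(1,0)$ and $(\psi_2,\dot\psi_2)(0)=(0,1)$, and let $\tau'_{m,p}(0)$ be the (one-sided) derivative of $\tau_{m,p}$ at $e=0$. The solution $\phi_{m,p}(\cdot,e)$ is called elliptic if $|\tau_{m,p}(e)|<2$, hyperbolic if $|\tau_{m,p}(e)|>2$, and linearized stable if the zero solution of (2) is Lyapunov stable. (i) If $\tau'_{m,p}(0)<0$, then there is $e_1\in(0,e_0]$ such that for every $e\in(0,e_1)$ the solution $\phi_{m,p}(\cdot,e)$ is elliptic and linearized stable. (ii)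 If $\tau'_{m,p}(0)>0$, then there is $e_1\in(0,e_0]$ such that for every $e\in(0,e_1)$ the solution $\phi_{m,p}(\cdot,e)$ is hyperbolic and is Lyapunov unstable as a solution of (1). -/

import Mathlib

open scoped ContDiff

noncomputable section

namespace NewtonEq

/-- `(x, v)` solves, in phase space, the Newtonian equation `x'' + G (x, t) = 0` on the time
set `s`: `x' = v` and `v' = -G (x, t)` on `s` (one-sided derivatives at end points). -/
def IsSolOn (G : ℝ → ℝ → ℝ) (x v : ℝ → ℝ) (s : Set ℝ) : Prop :=
  ∀ t ∈ s, HasDerivWithinAt x (v t) s t ∧ HasDerivWithinAt v (-G (x t) t) s t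

/-- `x` is a solution of `x'' + G (x, t) = 0` on the whole line. -/
def IsSol (G : ℝ → ℝ → ℝ) (x : ℝ → ℝ) : Prop :=
  IsSolOn G x (deriv x) Set.univ

/-- The standing assumptions on the equation `x'' + F (x, t, e) = 0`, with `f = F (·, ·, 0)`. -/
structure IsAdmissible (F : ℝ → ℝ → ℝ → ℝ) (f : ℝ → ℝ) : Prop where
  smooth : ContDiff ℝ ∞ (fun q : ℝ × ℝ × ℝ => F q.1 q.2.1 q.2.2)
  odd : ∀ x t e, F (-x) t e = -F x t e
  even_time : ∀ x t e, F x (-t) e = F x t e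
  periodic_time : ∀ x t e, F x (t + 2 * Real.pi) e = F x t e
  autonomous : ∀ x t, F x t 0 = f x
  sign : ∀ x, x ≠ 0 → 0 < x * f x

/-! ### The autonomous equation `x'' + f (x) = 0` -/

/-- The potential energy `E (x) = ∫₀ˣ f (u) du`. -/
def potential (f : ℝ → ℝ) (x : ℝ) : ℝ := ∫ u in (0 : ℝ)..x, f u

/-- `x` is a solution of `x'' + f (x) = 0` lying on the energy level `x'² / 2 + E (x) = h`. -/
def IsSolOfEnergy (f : ℝ → ℝ) (h : ℝ) (x : ℝ → ℝ) : Prop :=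
  IsSol (fun y _ => f y) x ∧ ∀ t, (deriv x t) ^ 2 / 2 + potential f (x t) = h

/-- The period function `T (h)`: the minimal period of the solutions of `x'' + f (x) = 0` of
energy `h`. It is meaningful for `0 < h < sup E`, where these solutions are nonconstant, periodic,
and time translates of each other. -/
def periodFn (f : ℝ → ℝ) (h : ℝ) : ℝ :=
  sInf {T : ℝ | 0 < T ∧ ∃ x : ℝ → ℝ, IsSolOfEnergy f h x ∧ Function.Periodic x T}

/-! ### Hill's equation `y'' + q (t) y = 0` -/

/-- The nonlinearity `(y, t) ↦ q (t) y` of Hill's equation `y'' + q (t) y = 0`. -/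
def hill (q : ℝ → ℝ) : ℝ → ℝ → ℝ := fun y t => q t * y

/-- The solution of Hill's equation with `y (0) = a`, `y' (0) = b`. -/
def hillSol (q : ℝ → ℝ) (a b : ℝ) : ℝ → ℝ :=
  Classical.epsilon fun y : ℝ → ℝ => IsSol (hill q) y ∧ y 0 = a ∧ deriv y 0 = b

/-- The `T`-periodic Poincaré matrix of Hill's equation, built from the fundamental solutions
`ψ₁ = hillSol q 1 0` and `ψ₂ = hillSol q 0 1`. -/
def poincareMatrix (q : ℝ → ℝ) (T : ℝ) : Matrix (Fin 2) (Fin 2) ℝ :=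
  !![hillSol q 1 0 T, hillSol q 0 1 T; deriv (hillSol q 1 0) T, deriv (hillSol q 0 1) T]

/-! ### Stability notions for a solution `φ` of `x'' + G (x, t) = 0` -/

/-- The coefficient `q (t) = ∂G/∂x (φ (t), t)` of the linearization along `φ`. -/
def linCoeff (G : ℝ → ℝ → ℝ) (φ : ℝ → ℝ) : ℝ → ℝ :=
  fun t => deriv (fun x => G x t) (φ t)

/-- The trace of the `T`-periodic Poincaré matrix of the linearization along `φ`. -/
def linTrace (G : ℝ → ℝ → ℝ) (φ : ℝ → ℝ) (T : ℝ) : ℝ :=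
  (poincareMatrix (linCoeff G φ) T).trace

/-- The `T`-periodic solution `φ` is elliptic. -/
def IsElliptic (G : ℝ → ℝ → ℝ) (φ : ℝ → ℝ) (T : ℝ) : Prop := |linTrace G φ T| < 2

/-- The `T`-periodic solution `φ` is hyperbolic. -/
def IsHyperbolic (G : ℝ → ℝ → ℝ) (φ : ℝ → ℝ) (T : ℝ) : Prop := 2 < |linTrace G φ T|

/-- Lyapunov stability of `φ` in the phase plane in forward time: solutions that start near
`(φ (0), φ' (0))` stay near `(φ, φ')` for as long as they exist. For locally Lipschitz `G` they
then exist for all `t ≥ 0`, because they cannot blow up. -/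
def LyapunovStable (G : ℝ → ℝ → ℝ) (φ : ℝ → ℝ) : Prop :=
  ∀ ε > 0, ∃ δ > 0, ∀ T ≥ 0, ∀ x v : ℝ → ℝ, IsSolOn G x v (Set.Icc 0 T) →
    |x 0 - φ 0| < δ → |v 0 - deriv φ 0| < δ →
    |x T - φ T| < ε ∧ |v T - deriv φ T| < ε

/-- `φ` is Lyapunov unstable. -/
def LyapunovUnstable (G : ℝ → ℝ → ℝ) (φ : ℝ → ℝ) : Prop := ¬ LyapunovStable G φ

/-- `φ` is linearized stable: the zero solution of its linearization is stable. -/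
def LinearizedStable (G : ℝ → ℝ → ℝ) (φ : ℝ → ℝ) : Prop :=
  LyapunovStable (hill (linCoeff G φ)) (fun _ => 0)

/-! ### The odd periodic solutions that bifurcate from the autonomous equation -/

/-- `φ (·, e)`, `0 ≤ e < e₀`, is the family of odd `2mπ`-periodic solutions of
`x'' + F (x, t, e) = 0` that emanates from the odd solution of energy `h` at `e = 0`:
`φ (·, e)` is the solution with `φ (0, e) = 0` and initial velocity `η (e)`, where `η` is smooth,
`η (0) = √(2h)` and `φ (mπ, e) = 0`. By the symmetries of `F`, a solution that vanishes at `0` and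
at `mπ` is odd and `2mπ`-periodic, so that asking it to be defined on all of `ℝ` is no
restriction. -/
structure IsOddFamily (F : ℝ → ℝ → ℝ → ℝ) (m : ℕ) (h e₀ : ℝ) (η : ℝ → ℝ) (φ : ℝ → ℝ → ℝ) :
    Prop where
  pos : 0 < e₀
  smooth : ContDiffOn ℝ ∞ η (Set.Ico 0 e₀)
  start : η 0 = Real.sqrt (2 * h)
  sol : ∀ e ∈ Set.Ico 0 e₀, IsSol (fun x t => F x t e) (fun t => φ t e)
  init_pos : ∀ e ∈ Set.Ico 0 e₀, φ 0 e = 0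
  init_vel : ∀ e ∈ Set.Ico 0 e₀, deriv (fun t => φ t e) 0 = η e
  dirichlet : ∀ e ∈ Set.Ico 0 e₀, φ (m * Real.pi) e = 0

/-- The trace `τ (e)` of the `2mπ`-periodic Poincaré matrix of the linearization of
`x'' + F (x, t, e) = 0` along `φ (·, e)`. -/
def familyTrace (F : ℝ → ℝ → ℝ → ℝ) (m : ℕ) (φ : ℝ → ℝ → ℝ) (e : ℝ) : ℝ :=
  linTrace (fun x t => F x t e) (fun t => φ t e) (2 * m * Real.pi)

end NewtonEq

end

/-!
At `e = 0` the velocity of the solution is a nontrivial periodic solution of the linearization, so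
that `1` is a multiplier and the trace of the Poincaré matrix, whose determinant is `1`, equals `2`.
For small `e > 0` the sign of `τ' (0)` therefore decides on which side of `2` the trace `τ (e)`
lies, and continuity keeps it above `-2`.

If `|τ| < 2` then `τ = 2 cos θ`, and the powers of the Poincaré matrix `M` are bounded because
`sin θ • M ^ n = sin (n θ) • M - sin (n θ - θ) • 1`. If `|τ| > 2` then the linearization has, after
doubling the period if `τ < -2`, Floquet solutions with growth rates `±ρ ≠ 0`. In the coordinates
`(a, b)` along them the full equation is a saddle up to a term that is small near the solution, and
there `a² - b²` grows exponentially.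
-/

open Set Filter Topology

namespace NewtonEq

/-! ### Global solutions of Lipschitz equations -/

/-- Bielecki's weight for the rate `κ`. In the norm `sup ‖z t‖ / bieleckiWeight κ t` the Picard
operator of an equation with Lipschitz constant `κ t` at time `t` is a contraction on all of `ℝ`. -/
noncomputable def bieleckiWeight (κ : ℝ → ℝ) (t : ℝ) : ℝ := Real.cosh (2 * ∫ s in (0 : ℝ)..t, κ s)

theorem one_le_bieleckiWeight (κ : ℝ → ℝ) (t : ℝ) : 1 ≤ bieleckiWeight κ t :=
  Real.one_le_cosh _

theorem bieleckiWeight_pos (κ : ℝ → ℝ) (t : ℝ) : 0 < bieleckiWeight κ t :=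
  Real.cosh_pos _

theorem continuous_bieleckiWeight {κ : ℝ → ℝ} (hκ : Continuous κ) :
    Continuous (bieleckiWeight κ) :=
  Real.continuous_cosh.comp
    (continuous_const.mul (intervalIntegral.continuous_primitive (fun a b =>
      hκ.intervalIntegrable a b) 0))

theorem abs_integral_mul_bieleckiWeight_le {κ : ℝ → ℝ} (hκ : Continuous κ) (t : ℝ) :
    |∫ s in (0 : ℝ)..t, κ s * bieleckiWeight κ s| ≤ bieleckiWeight κ t / 2 := by
  have hderiv : ∀ s, HasDerivAt (fun r => Real.sinh (2 * ∫ u in (0 : ℝ)..r, κ u) / 2)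
      (κ s * bieleckiWeight κ s) s := fun s => by
    convert! ((hκ.integral_hasStrictDerivAt 0 s).hasDerivAt.const_mul 2).sinh.div_const 2 using 1
    rw [bieleckiWeight]
    ring
  rw [intervalIntegral.integral_eq_sub_of_hasDerivAt (fun s _ => hderiv s)
    ((hκ.mul (continuous_bieleckiWeight hκ)).intervalIntegrable _ _),
    intervalIntegral.integral_same, mul_zero, Real.sinh_zero, zero_div, sub_zero, abs_div, abs_two,
    Real.abs_sinh, bieleckiWeight, ← Real.cosh_abs]
  gcongr
  exact (Real.sinh_lt_cosh _).le

section Picard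

variable {E : Type*} [NormedAddCommGroup E] [NormedSpace ℝ E]

theorem norm_integral_le_bieleckiWeight {κ : ℝ → ℝ} (hκ : Continuous κ) {g : ℝ → E} {M : ℝ}
    (hM : 0 ≤ M) (hg : ∀ s, ‖g s‖ ≤ M * (κ s * bieleckiWeight κ s)) (t : ℝ) :
    ‖∫ s in (0 : ℝ)..t, g s‖ ≤ M * (bieleckiWeight κ t / 2) := by
  have hint : Continuous fun s => M * (κ s * bieleckiWeight κ s) :=
    continuous_const.mul (hκ.mul (continuous_bieleckiWeight hκ))
  calc ‖∫ s in (0 : ℝ)..t, g s‖ ≤ |∫ s in (0 : ℝ)..t, M * (κ s * bieleckiWeight κ s)| :=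
        intervalIntegral.norm_integral_le_abs_of_norm_le (Eventually.of_forall hg)
          (hint.intervalIntegrable 0 t)
    _ = M * |∫ s in (0 : ℝ)..t, κ s * bieleckiWeight κ s| := by
        rw [intervalIntegral.integral_const_mul, abs_mul, abs_of_nonneg hM]
    _ ≤ M * (bieleckiWeight κ t / 2) := by
        gcongr
        exact abs_integral_mul_bieleckiWeight_le hκ t

/-- The Picard operator of `z' = f t z`, `z 0 = z₀`, written for `w = z / bieleckiWeight κ`, so that
Bielecki's norm of `z` is the supremum norm of `w`. -/
noncomputable def weightedPicard (κ : ℝ → ℝ) (f : ℝ → E → E) (z₀ : E) (w : ℝ → E) (t : ℝ) : E :=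
  (bieleckiWeight κ t)⁻¹ • (z₀ + ∫ s in (0 : ℝ)..t, f s (bieleckiWeight κ s • w s))

variable {κ : ℝ → ℝ} {f : ℝ → E → E}

theorem continuous_apply_bieleckiWeight_smul (hκ : Continuous κ)
    (hf : Continuous (Function.uncurry f)) {w : ℝ → E} (hw : Continuous w) :
    Continuous fun s => f s (bieleckiWeight κ s • w s) :=
  hf.comp (continuous_id.prodMk ((continuous_bieleckiWeight hκ).smul hw))

theorem continuous_weightedPicard (hκ : Continuous κ) (hf : Continuous (Function.uncurry f))
    (z₀ : E) {w : ℝ → E} (hw : Continuous w) : Continuous (weightedPicard κ f z₀ w) := by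
  refine ((continuous_bieleckiWeight hκ).inv₀ fun t => (bieleckiWeight_pos κ t).ne').smul
    (continuous_const.add (intervalIntegral.continuous_primitive (fun a b => ?_) 0))
  exact (continuous_apply_bieleckiWeight_smul hκ hf hw).intervalIntegrable a b

theorem norm_weightedPicard_le (hκ : Continuous κ)
    (hlip : ∀ t x y, ‖f t x - f t y‖ ≤ κ t * ‖x - y‖) (hzero : ∀ t, ‖f t 0‖ ≤ κ t) (z₀ : E)
    {w : ℝ → E} {M : ℝ} (hw : ∀ t, ‖w t‖ ≤ M) (t : ℝ) :
    ‖weightedPicard κ f z₀ w t‖ ≤ ‖z₀‖ + (M + 1) / 2 := by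
  have hM : 0 ≤ M := (norm_nonneg _).trans (hw 0)
  have hint := norm_integral_le_bieleckiWeight hκ (g := fun s => f s (bieleckiWeight κ s • w s))
    (M := M + 1) (by positivity) (fun s => ?_) t
  · have hW := one_le_bieleckiWeight κ t
    have hW₀ := bieleckiWeight_pos κ t
    rw [weightedPicard, norm_smul, norm_inv, Real.norm_of_nonneg hW₀.le, inv_mul_le_iff₀ hW₀]
    calc _ ≤ ‖z₀‖ + (M + 1) * (bieleckiWeight κ t / 2) := (norm_add_le _ _).trans (by gcongr)
      _ ≤ bieleckiWeight κ t * ‖z₀‖ + (M + 1) * (bieleckiWeight κ t / 2) := by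
        gcongr
        exact le_mul_of_one_le_left (norm_nonneg _) hW
      _ = _ := by ring
  · have hκ₀ : 0 ≤ κ s := (norm_nonneg _).trans (hzero s)
    have hW := one_le_bieleckiWeight κ s
    have hW₀ := bieleckiWeight_pos κ s
    calc ‖f s (bieleckiWeight κ s • w s)‖
        ≤ ‖f s (bieleckiWeight κ s • w s) - f s 0‖ + ‖f s 0‖ := norm_le_norm_sub_add _ _
      _ ≤ κ s * ‖bieleckiWeight κ s • w s - 0‖ + κ s * bieleckiWeight κ s := by
        gcongr
        · exact hlip s _ _
        · exact (hzero s).trans (le_mul_of_one_le_right hκ₀ hW)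
      _ = κ s * (bieleckiWeight κ s * ‖w s‖) + κ s * bieleckiWeight κ s := by
        rw [sub_zero, norm_smul, Real.norm_of_nonneg hW₀.le]
      _ ≤ κ s * (bieleckiWeight κ s * M) + κ s * bieleckiWeight κ s := by
        gcongr
        exact hw s
      _ = (M + 1) * (κ s * bieleckiWeight κ s) := by ring

theorem norm_weightedPicard_sub_le (hκ : Continuous κ) (hκ₀ : ∀ t, 0 ≤ κ t)
    (hf : Continuous (Function.uncurry f))
    (hlip : ∀ t x y, ‖f t x - f t y‖ ≤ κ t * ‖x - y‖) (z₀ : E) {w w' : ℝ → E}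
    (hw : Continuous w) (hw' : Continuous w') {M : ℝ} (hM : ∀ t, ‖w t - w' t‖ ≤ M) (t : ℝ) :
    ‖weightedPicard κ f z₀ w t - weightedPicard κ f z₀ w' t‖ ≤ M / 2 := by
  have hW₀ := bieleckiWeight_pos κ
  have hint := norm_integral_le_bieleckiWeight hκ (M := M) ((norm_nonneg _).trans (hM 0))
    (g := fun s => f s (bieleckiWeight κ s • w s) - f s (bieleckiWeight κ s • w' s))
    (fun s => ?_) t
  · rw [intervalIntegral.integral_sub
      ((continuous_apply_bieleckiWeight_smul hκ hf hw).intervalIntegrable _ _)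
      ((continuous_apply_bieleckiWeight_smul hκ hf hw').intervalIntegrable _ _)] at hint
    rw [weightedPicard, weightedPicard, ← smul_sub, add_sub_add_left_eq_sub, norm_smul, norm_inv,
      Real.norm_of_nonneg (hW₀ t).le, inv_mul_le_iff₀ (hW₀ t)]
    exact hint.trans_eq (by ring)
  · calc _ ≤ κ s * ‖bieleckiWeight κ s • w s - bieleckiWeight κ s • w' s‖ := hlip s _ _
      _ = κ s * (bieleckiWeight κ s * ‖w s - w' s‖) := by
        rw [← smul_sub, norm_smul, Real.norm_of_nonneg (hW₀ s).le]
      _ ≤ κ s * (bieleckiWeight κ s * M) := by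
        have := hκ₀ s
        have := (hW₀ s).le
        gcongr
        exact hM s
      _ = M * (κ s * bieleckiWeight κ s) := by ring

theorem exists_weightedPicard_eq_self [CompleteSpace E] (hκ : Continuous κ)
    (hf : Continuous (Function.uncurry f)) (hlip : ∀ t x y, ‖f t x - f t y‖ ≤ κ t * ‖x - y‖)
    (hzero : ∀ t, ‖f t 0‖ ≤ κ t) (z₀ : E) :
    ∃ w : ℝ → E, Continuous w ∧ weightedPicard κ f z₀ w = w := by
  let Φ : BoundedContinuousFunction ℝ E → BoundedContinuousFunction ℝ E := fun w =>
    .ofNormedAddCommGroup (weightedPicard κ f z₀ w)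
      (continuous_weightedPicard hκ hf z₀ w.continuous) _
      (norm_weightedPicard_le hκ hlip hzero z₀ w.norm_coe_le_norm)
  have hΦ : ContractingWith (1 / 2) Φ := by
    refine ⟨by rw [← NNReal.coe_lt_coe]; norm_num, LipschitzWith.of_dist_le_mul fun w w' => ?_⟩
    refine (BoundedContinuousFunction.dist_le (by positivity)).2 fun t => ?_
    have := norm_weightedPicard_sub_le hκ (fun t => (norm_nonneg _).trans (hzero t)) hf hlip z₀
      w.continuous w'.continuous (M := dist w w')
      (fun t => by simpa only [dist_eq_norm] using w.dist_coe_le_dist (g := w') t) t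
    simpa [Φ, dist_eq_norm, div_eq_inv_mul] using this
  exact ⟨_, hΦ.fixedPoint.continuous, congrArg DFunLike.coe hΦ.fixedPoint_isFixedPt⟩

theorem exists_hasDerivAt_of_lipschitz [CompleteSpace E] {k : ℝ → ℝ} (hk : Continuous k)
    (hf : Continuous (Function.uncurry f)) (hlip : ∀ t x y, ‖f t x - f t y‖ ≤ k t * ‖x - y‖)
    (z₀ : E) : ∃ z : ℝ → E, z 0 = z₀ ∧ ∀ t, HasDerivAt z (f t (z t)) t := by
  set κ : ℝ → ℝ := fun t => |k t| + ‖f t 0‖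
  have hκ : Continuous κ :=
    hk.abs.add (hf.comp (continuous_id.prodMk continuous_const)).norm
  obtain ⟨w, hw, hfix⟩ := exists_weightedPicard_eq_self (κ := κ) hκ hf
    (fun t x y => (hlip t x y).trans (mul_le_mul_of_nonneg_right
      ((le_abs_self _).trans (le_add_of_nonneg_right (norm_nonneg _))) (norm_nonneg _)))
    (fun t => le_add_of_nonneg_left (abs_nonneg _)) z₀
  have hint := continuous_apply_bieleckiWeight_smul hκ hf hw
  have hz : ∀ t, bieleckiWeight κ t • w t =
      z₀ + ∫ s in (0 : ℝ)..t, f s (bieleckiWeight κ s • w s) := fun t => by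
    conv_lhs => rw [← hfix, weightedPicard]
    rw [smul_inv_smul₀ (bieleckiWeight_pos κ t).ne']
  refine ⟨fun t => bieleckiWeight κ t • w t, by simp [hz 0], fun t => ?_⟩
  exact ((hint.integral_hasStrictDerivAt 0 t).hasDerivAt.const_add z₀).congr_of_eventuallyEq
    (Eventually.of_forall hz)

end Picard

/-! ### Phase plane and Hill's equation -/

/-- The vector field of `x'' + G (x, t) = 0` in the phase plane. -/
def phaseField (G : ℝ → ℝ → ℝ) (t : ℝ) (z : ℝ × ℝ) : ℝ × ℝ := (z.2, -G z.1 t)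

theorem norm_phaseField_sub_le {G : ℝ → ℝ → ℝ} {t K : ℝ} {z z' : ℝ × ℝ}
    (h : |G z.1 t - G z'.1 t| ≤ K * |z.1 - z'.1|) :
    ‖phaseField G t z - phaseField G t z'‖ ≤ max 1 K * ‖z - z'‖ := by
  refine norm_prod_le_iff.2 ⟨?_, ?_⟩
  · calc ‖z.2 - z'.2‖ ≤ 1 * ‖z - z'‖ := by rw [one_mul]; exact norm_snd_le (z - z')
      _ ≤ max 1 K * ‖z - z'‖ := by gcongr; exact le_max_left _ _
  · calc ‖-G z.1 t - -G z'.1 t‖ = |G z.1 t - G z'.1 t| := by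
          rw [neg_sub_neg, Real.norm_eq_abs, abs_sub_comm]
      _ ≤ max 1 K * |z.1 - z'.1| := h.trans (by gcongr; exact le_max_right _ _)
      _ ≤ max 1 K * ‖z - z'‖ := by gcongr; exact norm_fst_le (z - z')

section IsSolOn

variable {G : ℝ → ℝ → ℝ} {x v : ℝ → ℝ}

theorem isSolOn_univ_iff :
    IsSolOn G x v univ ↔ ∀ t, HasDerivAt x (v t) t ∧ HasDerivAt v (-G (x t) t) t := by
  simp only [IsSolOn, mem_univ, forall_const, hasDerivWithinAt_univ]

theorem IsSolOn.mono {s s' : Set ℝ} (h : IsSolOn G x v s') (hs : s ⊆ s') : IsSolOn G x v s :=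
  fun t ht => ⟨(h t (hs ht)).1.mono hs, (h t (hs ht)).2.mono hs⟩

theorem IsSolOn.hasDerivAt (h : IsSolOn G x v univ) (t : ℝ) :
    HasDerivAt x (v t) t ∧ HasDerivAt v (-G (x t) t) t :=
  isSolOn_univ_iff.1 h t

theorem IsSolOn.deriv_eq (h : IsSolOn G x v univ) : deriv x = v :=
  funext fun t => (h.hasDerivAt t).1.deriv

theorem IsSolOn.isSol (h : IsSolOn G x v univ) : IsSol G x := by
  rwa [IsSol, h.deriv_eq]

theorem IsSolOn.continuous (h : IsSolOn G x v univ) : Continuous x :=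
  continuous_iff_continuousAt.2 fun t => (h.hasDerivAt t).1.continuousAt

theorem IsSolOn.continuous_velocity (h : IsSolOn G x v univ) : Continuous v :=
  continuous_iff_continuousAt.2 fun t => (h.hasDerivAt t).2.continuousAt

theorem IsSolOn.comp_add_period {T : ℝ} (hG : ∀ x, Function.Periodic (G x) T)
    (h : IsSolOn G x v univ) : IsSolOn G (fun t => x (t + T)) (fun t => v (t + T)) univ :=
  isSolOn_univ_iff.2 fun t => ⟨(h.hasDerivAt (t + T)).1.comp_add_const t T,
    by simpa only [hG _ t] using (h.hasDerivAt (t + T)).2.comp_add_const t T⟩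

theorem exists_isSolOn_univ (hG : Continuous (Function.uncurry G)) {k : ℝ → ℝ}
    (hk : Continuous k) (hlip : ∀ t x y, |G x t - G y t| ≤ k t * |x - y|) (a b : ℝ) :
    ∃ x v : ℝ → ℝ, x 0 = a ∧ v 0 = b ∧ IsSolOn G x v univ := by
  have hfield : Continuous (Function.uncurry (phaseField G)) :=
    continuous_snd.snd.prodMk (hG.comp (continuous_snd.fst.prodMk continuous_fst)).neg
  obtain ⟨z, hz₀, hz⟩ := exists_hasDerivAt_of_lipschitz (continuous_const.max hk) hfield
    (fun t z z' => norm_phaseField_sub_le (hlip t z.1 z'.1)) (a, b)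
  refine ⟨fun t => (z t).1, fun t => (z t).2, congrArg Prod.fst hz₀, congrArg Prod.snd hz₀,
    isSolOn_univ_iff.2 fun t => ⟨?_, ?_⟩⟩
  · exact hasFDerivAt_fst.comp_hasDerivAt t (hz t)
  · exact hasFDerivAt_snd.comp_hasDerivAt t (hz t)

end IsSolOn

open Matrix

section Hill

variable {q : ℝ → ℝ}

theorem hillSol_spec (hq : Continuous q) (a b : ℝ) :
    IsSol (hill q) (hillSol q a b) ∧ hillSol q a b 0 = a ∧ deriv (hillSol q a b) 0 = b := by
  refine Classical.epsilon_spec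
    (p := fun y : ℝ → ℝ => IsSol (hill q) y ∧ y 0 = a ∧ deriv y 0 = b) ?_
  obtain ⟨x, v, hx₀, hv₀, hx⟩ := exists_isSolOn_univ (G := hill q)
    ((hq.comp continuous_snd).mul continuous_fst) hq.abs
    (fun t x y => by rw [hill, hill, ← mul_sub, abs_mul]) a b
  exact ⟨x, hx.isSol, hx₀, hx.deriv_eq ▸ hv₀⟩

theorem hill_wronskian_eq {x v y w : ℝ → ℝ} {s : Set ℝ} (hs : Convex ℝ s)
    (hx : IsSolOn (hill q) x v s) (hy : IsSolOn (hill q) y w s) {t t' : ℝ} (ht : t ∈ s)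
    (ht' : t' ∈ s) : x t * w t - v t * y t = x t' * w t' - v t' * y t' := by
  have hderiv : ∀ r ∈ s, HasDerivWithinAt (fun t => x t * w t - v t * y t) 0 s r := fun r hr => by
    convert! ((hx r hr).1.mul (hy r hr).2).sub ((hx r hr).2.mul (hy r hr).1) using 1
    simp only [hill]
    ring
  have := hs.norm_image_sub_le_of_norm_hasDerivWithin_le hderiv (C := 0) (by simp) ht' ht
  rwa [zero_mul, norm_le_zero_iff, sub_eq_zero] at this

theorem poincareMatrix_mulVec (q : ℝ → ℝ) (t : ℝ) (w : Fin 2 → ℝ) :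
    poincareMatrix q t *ᵥ w = ![hillSol q 1 0 t * w 0 + hillSol q 0 1 t * w 1,
      deriv (hillSol q 1 0) t * w 0 + deriv (hillSol q 0 1) t * w 1] := by
  ext i
  fin_cases i <;> simp [poincareMatrix, mulVec, dotProduct]

theorem poincareMatrix_zero (hq : Continuous q) : poincareMatrix q 0 = 1 := by
  obtain ⟨-, h₁, h₁'⟩ := hillSol_spec hq 1 0
  obtain ⟨-, h₂, h₂'⟩ := hillSol_spec hq 0 1
  rw [poincareMatrix, h₁, h₁', h₂, h₂', one_fin_two]

theorem continuous_poincareMatrix (hq : Continuous q) : Continuous (poincareMatrix q) := by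
  have h₁ := (hillSol_spec hq 1 0).1
  have h₂ := (hillSol_spec hq 0 1).1
  refine continuous_matrix fun i j => ?_
  fin_cases i <;> fin_cases j
  exacts [h₁.continuous, h₂.continuous, h₁.continuous_velocity, h₂.continuous_velocity]

theorem det_poincareMatrix (hq : Continuous q) (t : ℝ) : (poincareMatrix q t).det = 1 := by
  rw [← det_one (n := Fin 2) (R := ℝ), ← poincareMatrix_zero hq]
  have := hill_wronskian_eq convex_univ (hillSol_spec hq 1 0).1 (hillSol_spec hq 0 1).1
    (mem_univ t) (mem_univ 0)
  simp only [poincareMatrix, det_fin_two_of]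
  linarith

theorem IsSolOn.eq_poincareMatrix_mulVec (hq : Continuous q) {x v : ℝ → ℝ} {s : Set ℝ}
    (hs : Convex ℝ s) (h₀ : (0 : ℝ) ∈ s) (h : IsSolOn (hill q) x v s) {t : ℝ} (ht : t ∈ s) :
    ![x t, v t] = poincareMatrix q t *ᵥ ![x 0, v 0] := by
  obtain ⟨hψ₁, h₁, h₁'⟩ := hillSol_spec hq 1 0
  obtain ⟨hψ₂, h₂, h₂'⟩ := hillSol_spec hq 0 1
  have w₁ := hill_wronskian_eq hs h (IsSolOn.mono hψ₁ (subset_univ s)) ht h₀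
  have w₂ := hill_wronskian_eq hs h (IsSolOn.mono hψ₂ (subset_univ s)) ht h₀
  have hdet := det_poincareMatrix hq t
  rw [h₁, h₁'] at w₁
  rw [h₂, h₂'] at w₂
  rw [poincareMatrix, det_fin_two_of] at hdet
  rw [poincareMatrix_mulVec]
  refine vec2_eq ?_ ?_
  · simp only [cons_val_zero, cons_val_one]
    linear_combination (-x t) * hdet + hillSol q 1 0 t * w₂ - hillSol q 0 1 t * w₁
  · simp only [cons_val_zero, cons_val_one]
    linear_combination
      (-v t) * hdet + deriv (hillSol q 1 0) t * w₂ - deriv (hillSol q 0 1) t * w₁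

theorem isSolOn_poincareMatrix_mulVec (hq : Continuous q) (w : Fin 2 → ℝ) :
    IsSolOn (hill q) (fun t => (poincareMatrix q t *ᵥ w) 0)
      (fun t => (poincareMatrix q t *ᵥ w) 1) univ := by
  refine isSolOn_univ_iff.2 fun t => ?_
  have h₁ := IsSolOn.hasDerivAt (hillSol_spec hq 1 0).1 t
  have h₂ := IsSolOn.hasDerivAt (hillSol_spec hq 0 1).1 t
  simp only [poincareMatrix_mulVec, cons_val_zero, cons_val_one]
  refine ⟨(h₁.1.mul_const (w 0)).add (h₂.1.mul_const (w 1)), ?_⟩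
  convert! (h₁.2.mul_const (w 0)).add (h₂.2.mul_const (w 1)) using 1
  simp only [hill]
  ring

theorem poincareMatrix_add_period (hq : Continuous q) {T : ℝ} (hT : Function.Periodic q T)
    (t : ℝ) : poincareMatrix q (t + T) = poincareMatrix q t * poincareMatrix q T := by
  refine mulVec_injective (funext fun w => ?_)
  have := ((isSolOn_poincareMatrix_mulVec hq w).comp_add_period
    fun x t => by rw [hill, hill, hT t]).eq_poincareMatrix_mulVec hq convex_univ (mem_univ 0)
    (mem_univ t)
  rw [zero_add] at this
  have eta : ∀ v : Fin 2 → ℝ, ![v 0, v 1] = v := FinVec.etaExpand_eq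
  simpa only [eta, mulVec_mulVec] using this

theorem poincareMatrix_add_nat_mul_period (hq : Continuous q) {T : ℝ}
    (hT : Function.Periodic q T) (t : ℝ) (n : ℕ) :
    poincareMatrix q (t + n * T) = poincareMatrix q t * poincareMatrix q T ^ n := by
  induction n with
  | zero => simp
  | succ n ih =>
    rw [Nat.cast_succ, add_one_mul, ← add_assoc, poincareMatrix_add_period hq hT, ih, pow_succ,
      mul_assoc]

end Hill

section Elliptic

theorem sin_smul_pow {A : Type*} [Ring A] [Algebra ℝ A] {a : A} {θ : ℝ}
    (ha : a * a = (2 * Real.cos θ) • a - 1) (n : ℕ) :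
    Real.sin θ • a ^ n = Real.sin (n * θ) • a - Real.sin (n * θ - θ) • (1 : A) := by
  induction n with
  | zero => simp
  | succ n ih =>
    have hsin : Real.sin (n * θ + θ) =
        2 * Real.cos θ * Real.sin (n * θ) - Real.sin (n * θ - θ) := by
      rw [Real.sin_add, Real.sin_sub]
      ring
    calc Real.sin θ • a ^ (n + 1)
        = (Real.sin (n * θ) • a - Real.sin (n * θ - θ) • (1 : A)) * a := by
          rw [← ih, pow_succ, smul_mul_assoc]
      _ = Real.sin (n * θ + θ) • a - Real.sin (n * θ) • (1 : A) := by
          rw [sub_mul, smul_mul_assoc, ha, smul_mul_assoc, one_mul, hsin]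
          module
      _ = _ := by rw [Nat.cast_succ, add_one_mul, add_sub_cancel_right]

theorem exists_norm_pow_le {A : Type*} [NormedRing A] [NormedAlgebra ℝ A] {a : A} {τ : ℝ}
    (ha : a * a = τ • a - 1) (hτ : |τ| < 2) : ∃ C, ∀ n : ℕ, ‖a ^ n‖ ≤ C := by
  obtain ⟨hτ₁, hτ₂⟩ := abs_lt.1 hτ
  set θ := Real.arccos (τ / 2)
  have hcos : Real.cos θ = τ / 2 := Real.cos_arccos (by linarith) (by linarith)
  have hsin : 0 < Real.sin θ := by
    rw [Real.sin_arccos, Real.sqrt_pos]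
    nlinarith
  refine ⟨(‖a‖ + ‖(1 : A)‖) / Real.sin θ, fun n => (le_div_iff₀' hsin).2 ?_⟩
  calc Real.sin θ * ‖a ^ n‖ = ‖Real.sin (n * θ) • a - Real.sin (n * θ - θ) • (1 : A)‖ := by
        rw [← sin_smul_pow (by rw [hcos, ha, mul_div_cancel₀ _ two_ne_zero]), norm_smul,
          Real.norm_of_nonneg hsin.le]
    _ ≤ |Real.sin (n * θ)| * ‖a‖ + |Real.sin (n * θ - θ)| * ‖(1 : A)‖ :=
        (norm_sub_le _ _).trans_eq (by simp only [norm_smul, Real.norm_eq_abs])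
    _ ≤ 1 * ‖a‖ + 1 * ‖(1 : A)‖ := by gcongr <;> exact Real.abs_sin_le_one _
    _ = _ := by rw [one_mul, one_mul]

theorem mul_self_fin_two {R : Type*} [CommRing R] (M : Matrix (Fin 2) (Fin 2) R) :
    M * M = M.trace • M - M.det • 1 := by
  ext i j
  fin_cases i <;> fin_cases j <;> simp [mul_apply, trace_fin_two, det_fin_two] <;> ring

open scoped Matrix.Norms.Operator

variable {q : ℝ → ℝ}

theorem exists_norm_poincareMatrix_le (hq : Continuous q) {T : ℝ} (hT : 0 < T)
    (hqT : Function.Periodic q T) (htr : |(poincareMatrix q T).trace| < 2) :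
    ∃ C, ∀ t ≥ 0, ‖poincareMatrix q t‖ ≤ C := by
  obtain ⟨C₁, hC₁⟩ := (isCompact_Icc (a := 0) (b := T)).exists_bound_of_continuousOn
    (continuous_poincareMatrix hq).continuousOn
  obtain ⟨C₂, hC₂⟩ := exists_norm_pow_le (a := poincareMatrix q T)
    (by simpa [det_poincareMatrix hq] using mul_self_fin_two (poincareMatrix q T)) htr
  refine ⟨C₁ * C₂, fun t ht => ?_⟩
  set n := ⌊t / T⌋₊
  have hn : n * T ≤ t := (le_div_iff₀ hT).1 (Nat.floor_le (by positivity))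
  have hn' : t < (n + 1) * T := (div_lt_iff₀ hT).1 (Nat.lt_floor_add_one _)
  have hmem : t - n * T ∈ Icc 0 T := ⟨by linarith, by linarith⟩
  rw [← sub_add_cancel t (n * T), poincareMatrix_add_nat_mul_period hq hqT]
  exact (norm_mul_le _ _).trans (mul_le_mul (hC₁ _ hmem) (hC₂ n) (norm_nonneg _)
    ((norm_nonneg _).trans (hC₁ _ hmem)))

theorem lyapunovStable_hill_of_norm_le (hq : Continuous q) {C : ℝ}
    (hC : ∀ t ≥ 0, ‖poincareMatrix q t‖ ≤ C) : LyapunovStable (hill q) fun _ => 0 := by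
  intro ε hε
  have hC₀ : 0 ≤ C := (norm_nonneg _).trans (hC 0 le_rfl)
  refine ⟨ε / (C + 1), by positivity, fun t ht x v h hx hv => ?_⟩
  simp only [deriv_const, sub_zero] at hx hv ⊢
  have hmem : ‖![x 0, v 0]‖ < ε / (C + 1) :=
    (pi_norm_lt_iff (by positivity)).2 (Fin.forall_fin_two.2 ⟨hx, hv⟩)
  have hnorm : ‖![x t, v t]‖ < ε := by
    rw [h.eq_poincareMatrix_mulVec hq (convex_Icc 0 t) (left_mem_Icc.2 ht) (right_mem_Icc.2 ht)]
    calc _ ≤ ‖poincareMatrix q t‖ * ‖![x 0, v 0]‖ := linfty_opNorm_mulVec _ _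
      _ ≤ (C + 1) * ‖![x 0, v 0]‖ := by gcongr; linarith [hC t ht]
      _ < (C + 1) * (ε / (C + 1)) := by gcongr
      _ = ε := mul_div_cancel₀ _ (by positivity)
  exact Fin.forall_fin_two.1 ((pi_norm_lt_iff hε).1 hnorm)

theorem lyapunovStable_hill (hq : Continuous q) {T : ℝ} (hT : 0 < T)
    (hqT : Function.Periodic q T) (htr : |(poincareMatrix q T).trace| < 2) :
    LyapunovStable (hill q) fun _ => 0 :=
  have ⟨_, hC⟩ := exists_norm_poincareMatrix_le hq hT hqT htr
  lyapunovStable_hill_of_norm_le hq hC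

end Elliptic

section Smooth

variable {G : ℝ → ℝ → ℝ}

theorem differentiable_slice (hG : ContDiff ℝ 1 fun z : ℝ × ℝ => G z.1 z.2) (t : ℝ) :
    Differentiable ℝ fun x => G x t :=
  (hG.differentiable one_ne_zero).comp (differentiable_id.prodMk (differentiable_const t))

theorem continuous_deriv_slice (hG : ContDiff ℝ 1 fun z : ℝ × ℝ => G z.1 z.2) :
    Continuous fun z : ℝ × ℝ => deriv (fun x => G x z.2) z.1 := by
  have hderiv : ∀ z : ℝ × ℝ, deriv (fun x => G x z.2) z.1 =
      fderiv ℝ (fun z : ℝ × ℝ => G z.1 z.2) z (1, 0) := fun z => by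
    have h : HasFDerivAt (fun z : ℝ × ℝ => G z.1 z.2) _ (z.1, z.2) :=
      (hG.differentiable one_ne_zero z).hasFDerivAt
    exact (h.comp_hasDerivAt z.1 ((hasDerivAt_id z.1).prodMk (hasDerivAt_const z.1 z.2))).deriv
  simp only [hderiv]
  exact (hG.continuous_fderiv one_ne_zero).clm_apply continuous_const

theorem slice_sub_slice (hG : ContDiff ℝ 1 fun z : ℝ × ℝ => G z.1 z.2) (x y t : ℝ) :
    G x t - G y t =
      (∫ s in (0 : ℝ)..1, deriv (fun x => G x t) (y + s * (x - y))) * (x - y) := by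
  have hderiv : ∀ s, HasDerivAt (fun s => G (y + s * (x - y)) t)
      (deriv (fun x => G x t) (y + s * (x - y)) * (x - y)) s := fun s =>
    (differentiable_slice hG t _).hasDerivAt.comp s
      (by simpa using ((hasDerivAt_id s).mul_const (x - y)).const_add y)
  have hcont : Continuous fun s => deriv (fun x => G x t) (y + s * (x - y)) :=
    (continuous_deriv_slice hG).comp (f := fun s => (y + s * (x - y), t)) (by fun_prop)
  rw [← intervalIntegral.integral_mul_const, intervalIntegral.integral_eq_sub_of_hasDerivAt
    (fun s _ => hderiv s) ((hcont.mul continuous_const).intervalIntegrable _ _)]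
  simp

theorem IsSolOn.eq_zero_of_hill {q : ℝ → ℝ} (hq : Continuous q) {x v : ℝ → ℝ}
    (h : IsSolOn (hill q) x v univ) {t₀ : ℝ} (hx : x t₀ = 0) (hv : v t₀ = 0) (t : ℝ) :
    x t = 0 := by
  have hrep : ∀ s, ![x s, v s] = poincareMatrix q s *ᵥ ![x 0, v 0] := fun s =>
    h.eq_poincareMatrix_mulVec hq convex_univ (mem_univ 0) (mem_univ s)
  have hzero : ![x 0, v 0] = 0 := by
    refine eq_zero_of_mulVec_eq_zero (M := poincareMatrix q t₀) ?_ ?_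
    · rw [det_poincareMatrix hq]
      exact one_ne_zero
    · rw [← hrep, hx, hv]
      simp
  simpa [hzero] using congrFun (hrep t) 0

/-- The difference of two solutions solves a Hill equation, by Hadamard's formula. -/
theorem IsSolOn.unique (hG : ContDiff ℝ 1 fun z : ℝ × ℝ => G z.1 z.2) {x v y w : ℝ → ℝ}
    (hx : IsSolOn G x v univ) (hy : IsSolOn G y w univ) {t₀ : ℝ} (hxy : x t₀ = y t₀)
    (hvw : v t₀ = w t₀) : x = y := by
  set q : ℝ → ℝ := fun t => ∫ s in (0 : ℝ)..1, deriv (fun x => G x t) (y t + s * (x t - y t))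
  have hxc := hx.continuous
  have hyc := hy.continuous
  have hcont : Continuous (Function.uncurry fun t s =>
      deriv (fun x => G x t) (y t + s * (x t - y t))) :=
    (continuous_deriv_slice hG).comp
      (f := fun z : ℝ × ℝ => (y z.1 + z.2 * (x z.1 - y z.1), z.1)) (by fun_prop)
  have hq : Continuous q :=
    intervalIntegral.continuous_parametric_intervalIntegral_of_continuous' hcont 0 1
  have hdiff : IsSolOn (hill q) (fun t => x t - y t) (fun t => v t - w t) univ := by
    refine isSolOn_univ_iff.2 fun t => ⟨(hx.hasDerivAt t).1.sub (hy.hasDerivAt t).1, ?_⟩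
    convert! (hx.hasDerivAt t).2.sub (hy.hasDerivAt t).2 using 1
    rw [hill, ← slice_sub_slice hG]
    ring
  exact funext fun t => sub_eq_zero.1 <|
    hdiff.eq_zero_of_hill hq (sub_eq_zero.2 hxy) (sub_eq_zero.2 hvw) t

theorem IsSol.apply_two_mul_sub (hG : ContDiff ℝ 1 fun z : ℝ × ℝ => G z.1 z.2)
    (hodd : ∀ x t, G (-x) t = -G x t) {c : ℝ} (hrefl : ∀ x t, G x (2 * c - t) = G x t)
    {φ : ℝ → ℝ} (hφ : IsSol G φ) (hc : φ c = 0) (t : ℝ) : φ (2 * c - t) = -φ t := by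
  have hψ : IsSolOn G (fun t => -φ (2 * c - t)) (fun t => deriv φ (2 * c - t)) univ := by
    refine isSolOn_univ_iff.2 fun t => ?_
    have h := IsSolOn.hasDerivAt hφ (2 * c - t)
    refine ⟨?_, ?_⟩
    · convert! (h.1.comp_const_sub (2 * c) t).neg using 1
      ring
    · simpa only [hodd, hrefl, neg_neg] using h.2.comp_const_sub (2 * c) t
  have hcc : 2 * c - c = c := by ring
  exact neg_eq_iff_eq_neg.1 <|
    congrFun (hψ.unique hG hφ (t₀ := c) (by simp [hcc, hc]) (by simp [hcc])) t

theorem IsSol.periodic (hG : ContDiff ℝ 1 fun z : ℝ × ℝ => G z.1 z.2)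
    (hodd : ∀ x t, G (-x) t = -G x t) (heven : ∀ x t, G x (-t) = G x t) {c : ℝ}
    (hper : ∀ x, Function.Periodic (G x) (2 * c)) {φ : ℝ → ℝ} (hφ : IsSol G φ) (h₀ : φ 0 = 0)
    (hc : φ c = 0) : Function.Periodic φ (2 * c) := fun t => by
  have hodd₀ : φ (-t) = -φ t := by
    simpa using hφ.apply_two_mul_sub hG hodd (c := 0) (by simpa using heven) h₀ t
  have hodd_c : φ (2 * c - -t) = -φ (-t) :=
    hφ.apply_two_mul_sub hG hodd
      (fun x s => by rw [sub_eq_neg_add, hper x, heven]) hc (-t)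
  rw [show t + 2 * c = 2 * c - -t by ring, hodd_c, hodd₀, neg_neg]

theorem continuous_linCoeff (hG : ContDiff ℝ 1 fun z : ℝ × ℝ => G z.1 z.2) {φ : ℝ → ℝ}
    (hφ : Continuous φ) : Continuous (linCoeff G φ) :=
  (continuous_deriv_slice hG).comp (hφ.prodMk continuous_id)

theorem periodic_linCoeff {φ : ℝ → ℝ} {T : ℝ} (hG : ∀ x, Function.Periodic (G x) T)
    (hφ : Function.Periodic φ T) : Function.Periodic (linCoeff G φ) T := fun t => by
  simp only [linCoeff, hφ t, hG _ t]

theorem linearizedStable_of_isElliptic (hG : ContDiff ℝ 1 fun z : ℝ × ℝ => G z.1 z.2)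
    {φ : ℝ → ℝ} (hφ : Continuous φ) {T : ℝ} (hT : 0 < T)
    (hGT : ∀ x, Function.Periodic (G x) T) (hφT : Function.Periodic φ T)
    (hell : IsElliptic G φ T) : LinearizedStable G φ :=
  lyapunovStable_hill (continuous_linCoeff hG hφ) hT (periodic_linCoeff hGT hφT) hell

end Smooth

theorem exists_mulVec_eq_smul_iff {K : Type*} [Field K] {M : Matrix (Fin 2) (Fin 2) K} {l : K} :
    (∃ v ≠ 0, M *ᵥ v = l • v) ↔ l ^ 2 - M.trace * l + M.det = 0 := by
  have hdet : (M - l • 1).det = l ^ 2 - M.trace * l + M.det := by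
    simp only [det_fin_two, trace_fin_two, Matrix.sub_apply, Matrix.smul_apply, one_apply_eq,
      one_apply_ne, smul_eq_mul, ne_eq, zero_ne_one, one_ne_zero, not_false_eq_true]
    ring
  simp only [← hdet, ← exists_mulVec_eq_zero_iff, sub_mulVec, smul_mulVec, one_mulVec, sub_eq_zero]

theorem linTrace_autonomous {f : ℝ → ℝ} (hf : ContDiff ℝ 1 f) {φ : ℝ → ℝ}
    (hφ : IsSol (fun x _ => f x) φ) {T : ℝ} (hφT : Function.Periodic φ T) {t₀ : ℝ}
    (ht₀ : deriv φ t₀ ≠ 0) : linTrace (fun x _ => f x) φ T = 2 := by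
  set q := linCoeff (fun x _ => f x) φ
  have hq : Continuous q := continuous_linCoeff (hf.comp contDiff_fst) hφ.continuous
  have hderiv : IsSolOn (hill q) (deriv φ) (fun t => -f (φ t)) univ :=
    isSolOn_univ_iff.2 fun t => ⟨(IsSolOn.hasDerivAt hφ t).2,
      ((hf.differentiable one_ne_zero (φ t)).hasDerivAt.comp t (IsSolOn.hasDerivAt hφ t).1).neg⟩
  have hfix : poincareMatrix q T *ᵥ ![deriv φ 0, -f (φ 0)] = (1 : ℝ) • ![deriv φ 0, -f (φ 0)] := by
    have hφ0 : φ T = φ 0 := by simpa using hφT 0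
    have hφ0' : deriv φ T = deriv φ 0 := by
      simpa [show (fun t => φ (t + T)) = φ from funext hφT] using
        (deriv_comp_add_const φ T 0).symm
    rw [← hderiv.eq_poincareMatrix_mulVec hq convex_univ (mem_univ 0) (mem_univ T), hφ0, hφ0',
      one_smul]
  have hne : ![deriv φ 0, -f (φ 0)] ≠ 0 := fun h =>
    ht₀ (hderiv.eq_zero_of_hill hq (congrFun h 0) (congrFun h 1) t₀)
  have := exists_mulVec_eq_smul_iff.1 ⟨_, hne, hfix⟩
  rw [det_poincareMatrix hq] at this
  rw [linTrace]
  linarith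

/-! ### Instability of hyperbolic solutions -/

section Saddle

variable {a b α β : ℝ → ℝ} {ρ : ℝ}

/-- `a² - b²` is a Chetaev function for the saddle `a' = ρ a`, `b' = -ρ b`. -/
theorem exp_mul_sq_sub_sq_le (hρ : 0 ≤ ρ) (ha : ∀ t, HasDerivAt a (ρ * a t + α t) t)
    (hb : ∀ t, HasDerivAt b (-ρ * b t + β t) t)
    (hα : ∀ t ≥ 0, |α t| ≤ ρ / 4 * (|a t| + |b t|))
    (hβ : ∀ t ≥ 0, |β t| ≤ ρ / 4 * (|a t| + |b t|)) {t : ℝ} (ht : 0 ≤ t) :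
    Real.exp (ρ * t) * (a 0 ^ 2 - b 0 ^ 2) ≤ a t ^ 2 - b t ^ 2 := by
  set Z : ℝ → ℝ := fun t => Real.exp (-(ρ * t)) * (a t ^ 2 - b t ^ 2)
  have hZ : ∀ t, HasDerivAt Z (Real.exp (-(ρ * t)) *
      (ρ * a t ^ 2 + 3 * ρ * b t ^ 2 + 2 * (a t * α t - b t * β t))) t := fun t => by
    convert! ((hasDerivAt_id t).const_mul ρ).neg.exp.mul (((ha t).pow 2).sub ((hb t).pow 2)) using 1
    simp only [id_eq, Pi.neg_apply, Pi.sub_apply, Pi.pow_apply, Nat.cast_ofNat,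
      Nat.add_one_sub_one, pow_one]
    ring
  have hmono : MonotoneOn Z (Ici 0) := by
    refine monotoneOn_of_deriv_nonneg (convex_Ici 0)
      (fun t _ => (hZ t).continuousAt.continuousWithinAt)
      (fun t _ => (hZ t).differentiableAt.differentiableWithinAt) fun t ht => ?_
    have ht₀ : 0 ≤ t := interior_subset ht
    have hsmall : |a t * α t - b t * β t| ≤ ρ / 2 * (a t ^ 2 + b t ^ 2) := by
      calc |a t * α t - b t * β t| ≤ |a t| * |α t| + |b t| * |β t| := by
            rw [← abs_mul, ← abs_mul]
            exact abs_sub _ _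
        _ ≤ |a t| * (ρ / 4 * (|a t| + |b t|)) + |b t| * (ρ / 4 * (|a t| + |b t|)) := by
            gcongr
            exacts [hα t ht₀, hβ t ht₀]
        _ = ρ / 4 * (|a t| + |b t|) ^ 2 := by ring
        _ ≤ ρ / 4 * (2 * (|a t| ^ 2 + |b t| ^ 2)) := by
            gcongr
            exact add_sq_le
        _ = ρ / 2 * (a t ^ 2 + b t ^ 2) := by
            rw [sq_abs, sq_abs]
            ring
    rw [(hZ t).deriv]
    refine mul_nonneg (Real.exp_pos _).le ?_
    linarith [(abs_le.1 hsmall).1, mul_nonneg hρ (sq_nonneg (b t))]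
  have hZt := hmono self_mem_Ici ht ht
  simp only [Z, Real.exp_neg, mul_zero, Real.exp_zero, inv_one, one_mul] at hZt
  exact (le_inv_mul_iff₀ (Real.exp_pos _)).1 hZt

theorem exists_lt_abs_of_saddle (hρ : 0 < ρ) (ha : ∀ t, HasDerivAt a (ρ * a t + α t) t)
    (hb : ∀ t, HasDerivAt b (-ρ * b t + β t) t)
    (hα : ∀ t ≥ 0, |α t| ≤ ρ / 4 * (|a t| + |b t|))
    (hβ : ∀ t ≥ 0, |β t| ≤ ρ / 4 * (|a t| + |b t|)) (h₀ : |b 0| < |a 0|) (C : ℝ) :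
    ∃ t ≥ 0, C < |a t| := by
  have hpos : 0 < a 0 ^ 2 - b 0 ^ 2 := sub_pos.2 (sq_lt_sq.2 h₀)
  have hgrow : Tendsto (fun t => Real.exp (ρ * t) * (a 0 ^ 2 - b 0 ^ 2)) atTop atTop :=
    (Real.tendsto_exp_atTop.comp (tendsto_id.const_mul_atTop hρ)).atTop_mul_const hpos
  obtain ⟨t, hCt, ht⟩ := ((hgrow.eventually_gt_atTop (C ^ 2)).and (eventually_ge_atTop 0)).exists
  have hsq : C ^ 2 < a t ^ 2 := by
    linarith [exp_mul_sq_sub_sq_le hρ.le ha hb hα hβ ht, sq_nonneg (b t)]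
  exact ⟨t, ht, (le_abs_self C).trans_lt (sq_lt_sq.1 hsq)⟩

end Saddle

section Floquet

/-- `e ^ (σ t) (p, r)` is a solution, in phase space, of Hill's equation `y'' + q (t) y = 0`, and
its Floquet factors `p` and `r` are `T`-periodic. -/
structure IsFloquet (q : ℝ → ℝ) (T σ : ℝ) (p r : ℝ → ℝ) : Prop where
  hasDerivAt_fst : ∀ t, HasDerivAt p (r t - σ * p t) t
  hasDerivAt_snd : ∀ t, HasDerivAt r (-(q t * p t) - σ * r t) t
  periodic_fst : Function.Periodic p T
  periodic_snd : Function.Periodic r T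

variable {q : ℝ → ℝ} {T σ : ℝ} {p r : ℝ → ℝ}

theorem exists_isFloquet (hq : Continuous q) (hqT : Function.Periodic q T) {w : Fin 2 → ℝ}
    (hw : poincareMatrix q T *ᵥ w = Real.exp (σ * T) • w) :
    ∃ p r : ℝ → ℝ, p 0 = w 0 ∧ r 0 = w 1 ∧ IsFloquet q T σ p r := by
  have hsol := (isSolOn_poincareMatrix_mulVec hq w).hasDerivAt
  have hexp : ∀ t, HasDerivAt (fun t => Real.exp (-(σ * t))) (-σ * Real.exp (-(σ * t))) t :=
    fun t => by
      convert! ((hasDerivAt_id t).const_mul σ).neg.exp using 1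
      simp only [id_eq, Pi.neg_apply]
      ring
  have hper : ∀ i, Function.Periodic
      (fun t => Real.exp (-(σ * t)) * (poincareMatrix q t *ᵥ w) i) T := fun i t => by
    simp only [poincareMatrix_add_period hq hqT, ← mulVec_mulVec, hw, mulVec_smul, Pi.smul_apply,
      smul_eq_mul, ← mul_assoc, ← Real.exp_add]
    ring_nf
  refine ⟨_, _, by simp [poincareMatrix_zero hq], by simp [poincareMatrix_zero hq],
    fun t => ?_, fun t => ?_, hper 0, hper 1⟩
  · convert! (hexp t).mul (hsol t).1 using 1
    ring
  · convert! (hexp t).mul (hsol t).2 using 1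
    simp only [hill]
    ring

theorem IsFloquet.exists_abs_le (h : IsFloquet q T σ p r) (hT : T ≠ 0) :
    ∃ C, ∀ t, |p t| ≤ C ∧ |r t| ≤ C := by
  obtain ⟨C₁, hC₁⟩ := (h.periodic_fst.isBounded_of_continuous hT <|
    continuous_iff_continuousAt.2 fun t => (h.hasDerivAt_fst t).continuousAt).exists_norm_le
  obtain ⟨C₂, hC₂⟩ := (h.periodic_snd.isBounded_of_continuous hT <|
    continuous_iff_continuousAt.2 fun t => (h.hasDerivAt_snd t).continuousAt).exists_norm_le
  exact ⟨max C₁ C₂, fun t => ⟨(hC₁ _ (mem_range_self t)).trans (le_max_left _ _),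
    (hC₂ _ (mem_range_self t)).trans (le_max_right _ _)⟩⟩

theorem IsFloquet.wronskian_eq (h : IsFloquet q T σ p r) {T' : ℝ} {p' r' : ℝ → ℝ}
    (h' : IsFloquet q T' (-σ) p' r') (t : ℝ) :
    p' t * r t - r' t * p t = p' 0 * r 0 - r' 0 * p 0 := by
  have hderiv : ∀ t, HasDerivAt (fun t => p' t * r t - r' t * p t) 0 t := fun t => by
    convert! ((h'.hasDerivAt_fst t).mul (h.hasDerivAt_snd t)).sub
      ((h'.hasDerivAt_snd t).mul (h.hasDerivAt_fst t)) using 1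
    ring
  exact is_const_of_deriv_eq_zero (fun t => (hderiv t).differentiableAt)
    (fun t => (hderiv t).deriv) t 0

theorem IsFloquet.hasDerivAt_coord (h : IsFloquet q T σ p r) {H : ℝ → ℝ → ℝ} {u v : ℝ → ℝ}
    (hu : IsSolOn H u v univ) (t : ℝ) :
    HasDerivAt (fun t => p t * v t - r t * u t)
      (-σ * (p t * v t - r t * u t) + -(p t * (H (u t) t - q t * u t))) t := by
  convert! ((h.hasDerivAt_fst t).mul (hu.hasDerivAt t).2).sub
    ((h.hasDerivAt_snd t).mul (hu.hasDerivAt t).1) using 1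
  ring

theorem abs_mul_sub_mul_le {x y z w C : ℝ} (hx : |x| ≤ C) (hz : |z| ≤ C) :
    |x * y - z * w| ≤ C * (|y| + |w|) := by
  calc |x * y - z * w| ≤ |x| * |y| + |z| * |w| := by
        rw [← abs_mul, ← abs_mul]
        exact abs_sub _ _
    _ ≤ C * |y| + C * |w| := by gcongr
    _ = C * (|y| + |w|) := by ring

/-- In the coordinates `a = p' v - r' u` and `b = p v - r u` the equation for `u` is a perturbed
saddle, and `p a - p' b` recovers `u` up to the constant Wronskian. -/
theorem IsFloquet.exists_lt_norm {ρ : ℝ} (hρ : 0 < ρ) (h : IsFloquet q T ρ p r)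
    {p' r' : ℝ → ℝ} (h' : IsFloquet q T (-ρ) p' r') {C w : ℝ}
    (hC : 0 < C) (hb : ∀ t, |p t| ≤ C ∧ |r t| ≤ C) (hb' : ∀ t, |p' t| ≤ C ∧ |r' t| ≤ C)
    (hw : p' 0 * r 0 - r' 0 * p 0 = w) (hw₀ : w ≠ 0) {H : ℝ → ℝ → ℝ} {u v : ℝ → ℝ}
    (hu : IsSolOn H u v univ)
    (hsmall : ∀ t ≥ 0, |H (u t) t - q t * u t| ≤ ρ * |w| / (4 * C ^ 2) * |u t|) {s : ℝ}
    (hs : s ≠ 0) (hu₀ : u 0 = s * p 0) (hv₀ : v 0 = s * r 0) (B : ℝ) :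
    ∃ t ≥ 0, B < ‖(u t, v t)‖ := by
  set a : ℝ → ℝ := fun t => p' t * v t - r' t * u t with ha
  set b : ℝ → ℝ := fun t => p t * v t - r t * u t with hb_def
  set g : ℝ → ℝ := fun t => H (u t) t - q t * u t
  have hwu : ∀ t, |w| * |u t| ≤ C * (|a t| + |b t|) := fun t => by
    have hident : w * u t = p t * a t - p' t * b t := by
      rw [← hw, ← h.wronskian_eq h' t]
      simp only [ha, hb_def]
      ring
    rw [← abs_mul, hident]
    exact abs_mul_sub_mul_le (hb t).1 (hb' t).1
  have hg : ∀ y, |y| ≤ C → ∀ t ≥ 0, |-(y * g t)| ≤ ρ / 4 * (|a t| + |b t|) := fun y hy t ht => by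
    calc |-(y * g t)| = |y| * |g t| := by rw [abs_neg, abs_mul]
      _ ≤ C * (ρ * |w| / (4 * C ^ 2) * |u t|) := by gcongr; exact hsmall t ht
      _ = ρ / (4 * C) * (|w| * |u t|) := by field_simp
      _ ≤ ρ / (4 * C) * (C * (|a t| + |b t|)) := mul_le_mul_of_nonneg_left (hwu t) (by positivity)
      _ = ρ / 4 * (|a t| + |b t|) := by field_simp
  have ha₀ : a 0 = s * w := by
    rw [← hw]
    simp only [ha, hu₀, hv₀]
    ring
  have hb₀ : b 0 = 0 := by
    simp only [hb_def, hu₀, hv₀]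
    ring
  have hab₀ : |b 0| < |a 0| := by
    rw [ha₀, hb₀, abs_zero]
    positivity
  obtain ⟨t, ht, hBt⟩ := exists_lt_abs_of_saddle hρ
    (fun t => by simpa only [neg_neg] using h'.hasDerivAt_coord hu t) (h.hasDerivAt_coord hu)
    (fun t => hg _ (hb' t).1 t) (fun t => hg _ (hb t).1 t) hab₀ (C * (B + B))
  refine ⟨t, ht, ?_⟩
  by_contra! hle
  exact hBt.not_ge <| (abs_mul_sub_mul_le (hb' t).1 (hb' t).2).trans <|
    mul_le_mul_of_nonneg_left (add_le_add ((norm_snd_le _).trans hle) ((norm_fst_le _).trans hle))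
      hC.le

theorem exists_eigenvectors_of_two_lt_trace {M : Matrix (Fin 2) (Fin 2) ℝ} (hdet : M.det = 1)
    (htr : 2 < M.trace) : ∃ l > (1 : ℝ), ∃ v w : Fin 2 → ℝ, M *ᵥ v = l • v ∧ M *ᵥ w = l⁻¹ • w ∧
      w 0 * v 1 - w 1 * v 0 ≠ 0 := by
  obtain ⟨l, hl, hroot⟩ : ∃ l > 1, l ^ 2 - M.trace * l + 1 = 0 := by
    have hsq := Real.sq_sqrt (show 0 ≤ M.trace ^ 2 - 4 by nlinarith)
    refine ⟨(M.trace + √(M.trace ^ 2 - 4)) / 2, ?_, by linear_combination hsq / 4⟩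
    linarith [Real.sqrt_nonneg (M.trace ^ 2 - 4)]
  have hl₀ : l ≠ 0 := by positivity
  obtain ⟨v, hv₀, hv⟩ := exists_mulVec_eq_smul_iff.2 (by rw [hdet, hroot])
  obtain ⟨w, hw₀, hw⟩ := (exists_mulVec_eq_smul_iff (l := l⁻¹)).2 (by
    rw [hdet]
    field_simp
    linear_combination hroot)
  refine ⟨l, hl, v, w, hv, hw, ?_⟩
  have hli : LinearIndependent ℝ ![w, v] := by
    refine Module.End.eigenvectors_linearIndependent' M.mulVecLin ![l⁻¹, l] ?_ _ ?_
    · exact injective_pair_iff_ne.2 ((inv_lt_one_of_one_lt₀ hl).trans hl).ne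
    · refine Fin.forall_fin_two.2 ⟨⟨?_, hw₀⟩, ⟨?_, hv₀⟩⟩
      · exact Module.End.mem_eigenspace_iff.2 hw
      · exact Module.End.mem_eigenspace_iff.2 hv
  have := (isUnit_iff_isUnit_det _).1 (linearIndependent_rows_iff_isUnit (A := of ![w, v]).1 hli)
  simpa [det_fin_two] using this.ne_zero

theorem exists_unstable_direction (hq : Continuous q) (hT : 0 < T) (hqT : Function.Periodic q T)
    (htr : 2 < (poincareMatrix q T).trace) : ∃ κ > 0, ∃ w : ℝ × ℝ, ∀ {H : ℝ → ℝ → ℝ}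
      {u v : ℝ → ℝ}, IsSolOn H u v univ →
      (∀ t ≥ 0, |H (u t) t - q t * u t| ≤ κ * |u t|) → ∀ s ≠ (0 : ℝ), (u 0, v 0) = s • w →
      ∀ B, ∃ t ≥ 0, B < ‖(u t, v t)‖ := by
  obtain ⟨l, hl, x, y, hx, hy, hxy⟩ :=
    exists_eigenvectors_of_two_lt_trace (det_poincareMatrix hq T) htr
  set ρ := Real.log l / T with hρ_def
  have hρ : 0 < ρ := div_pos (Real.log_pos hl) hT
  have hexp : Real.exp (ρ * T) = l := by
    rw [hρ_def, div_mul_cancel₀ _ hT.ne', Real.exp_log (by positivity)]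
  obtain ⟨p, r, hp₀, hr₀, h⟩ := exists_isFloquet (σ := ρ) hq hqT (by rw [hexp, hx])
  obtain ⟨p', r', hp₀', hr₀', h'⟩ :=
    exists_isFloquet (σ := -ρ) hq hqT (by rw [neg_mul, Real.exp_neg, hexp, hy])
  obtain ⟨C₁, hC₁⟩ := h.exists_abs_le hT.ne'
  obtain ⟨C₂, hC₂⟩ := h'.exists_abs_le hT.ne'
  set C := max 1 (max C₁ C₂)
  have hC : 0 < C := by positivity
  have h₁ : C₁ ≤ C := (le_max_left _ _).trans (le_max_right _ _)
  have h₂ : C₂ ≤ C := (le_max_right _ _).trans (le_max_right _ _)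
  refine ⟨ρ * |y 0 * x 1 - y 1 * x 0| / (4 * C ^ 2), by positivity, (p 0, r 0),
    fun hu hsmall s hs h₀ => ?_⟩
  exact h.exists_lt_norm hρ h' hC (fun t => ⟨(hC₁ t).1.trans h₁, (hC₁ t).2.trans h₁⟩)
    (fun t => ⟨(hC₂ t).1.trans h₂, (hC₂ t).2.trans h₂⟩)
    (by rw [hp₀, hr₀, hp₀', hr₀']) hxy hu hsmall hs (congrArg Prod.fst h₀) (congrArg Prod.snd h₀)

end Floquet

section Instability

theorem forall_lt_of_forall_le_imp_lt {f : ℝ → ℝ} {c : ℝ} (hf : Continuous f) (h₀ : f 0 < c)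
    (hexit : ∀ t ≥ 0, (∀ s ∈ Icc 0 t, f s ≤ c) → f t < c) : ∀ t ≥ 0, f t < c := by
  by_contra! hcon
  obtain ⟨t, ht, hct⟩ := hcon
  obtain ⟨t₁, ⟨ht₁, hct₁⟩, hleast⟩ : ∃ t₁, IsLeast (Icc 0 t ∩ {s | c ≤ f s}) t₁ :=
    (isCompact_Icc.inter_right (isClosed_le continuous_const hf)).exists_isLeast
      ⟨t, right_mem_Icc.2 ht, hct⟩
  obtain ⟨r, hr, hcr⟩ := intermediate_value_Icc ht₁.1 hf.continuousOn ⟨h₀.le, hct₁⟩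
  have hrt₁ : r = t₁ := hr.2.antisymm (hleast ⟨⟨hr.1, hr.2.trans ht₁.2⟩, hcr.ge⟩)
  refine (hexit t₁ ht₁.1 fun s hs => ?_).ne (hrt₁ ▸ hcr)
  by_contra! hlt
  have hst₁ : s = t₁ := hs.2.antisymm (hleast ⟨⟨hs.1, hs.2.trans ht₁.2⟩, hlt.le⟩)
  exact hlt.ne' (hst₁ ▸ hrt₁ ▸ hcr)

theorem exists_extension_of_lipschitz {R : ℝ → ℝ → ℝ} (hR : Continuous (Function.uncurry R))
    {a b κ : ℝ} (hab : a ≤ b)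
    (hlip : ∀ t, ∀ x ∈ Icc a b, ∀ y ∈ Icc a b, |R x t - R y t| ≤ κ * |x - y|) (hκ : 0 ≤ κ) :
    ∃ R' : ℝ → ℝ → ℝ, Continuous (Function.uncurry R') ∧ (∀ t, ∀ x ∈ Icc a b, R' x t = R x t) ∧
      ∀ t x y, |R' x t - R' y t| ≤ κ * |x - y| := by
  refine ⟨fun x t => R (projIcc a b hab x) t, ?_, fun t x hx => ?_, fun t x y => ?_⟩
  · exact hR.comp (f := fun z : ℝ × ℝ => ((projIcc a b hab z.1 : ℝ), z.2)) (by fun_prop)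
  · exact congrArg (fun z : Icc a b => R z t) (projIcc_of_mem hab hx)
  · have hproj : |(projIcc a b hab x : ℝ) - projIcc a b hab y| ≤ |x - y| := by
      simpa [Real.dist_eq, Subtype.dist_eq] using (LipschitzWith.projIcc hab).dist_le_mul x y
    exact (hlip t _ (projIcc a b hab x).2 _ (projIcc a b hab y).2).trans
      (mul_le_mul_of_nonneg_left hproj hκ)

theorem exists_isSolOn_univ_mul_add {q : ℝ → ℝ} (hq : Continuous q) {R : ℝ → ℝ → ℝ}
    (hR : Continuous (Function.uncurry R)) {κ : ℝ}
    (hlip : ∀ t x y, |R x t - R y t| ≤ κ * |x - y|) (a b : ℝ) :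
    ∃ u v : ℝ → ℝ, u 0 = a ∧ v 0 = b ∧ IsSolOn (fun x t => q t * x + R x t) u v univ := by
  refine exists_isSolOn_univ (G := fun x t => q t * x + R x t) (k := fun t => |q t| + κ)
    (((hq.comp continuous_snd).mul continuous_fst).add hR) (hq.abs.add continuous_const)
    (fun t x y => ?_) a b
  rw [add_sub_add_comm, ← mul_sub, add_mul, ← abs_mul]
  exact (abs_add_le _ _).trans (by gcongr; exact hlip t x y)

variable {H G : ℝ → ℝ → ℝ} {T : ℝ}

theorem exists_forall_abs_sub_linCoeff_mul_sub_le (hH : ContDiff ℝ 1 fun z : ℝ × ℝ => H z.1 z.2)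
    (hT : 0 < T) (hHT : ∀ x, Function.Periodic (H x) T) {κ : ℝ} (hκ : 0 < κ) :
    ∃ ε > 0, ∀ t, ∀ x ∈ Icc (-ε) ε, ∀ y ∈ Icc (-ε) ε,
      |(H x t - linCoeff H (fun _ => 0) t * x) - (H y t - linCoeff H (fun _ => 0) t * y)| ≤
        κ * |x - y| := by
  set D : ℝ → ℝ → ℝ := fun t x => deriv (fun x => H x t) x with hD_def
  have hD : Continuous fun z : ℝ × ℝ => D z.2 z.1 := continuous_deriv_slice hH
  have hDT : Function.Periodic D T := fun t => by simp only [hD_def, hHT _ t]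
  have hnear : ∀ᶠ x in 𝓝 (0 : ℝ), ∀ t ∈ Icc 0 T, |D t x - D t 0| < κ :=
    isCompact_Icc.eventually_forall_of_forall_eventually fun t _ => by
      have hcont : Continuous fun z : ℝ × ℝ => |D z.2 z.1 - D z.2 0| :=
        (hD.sub (hD.comp (f := fun z : ℝ × ℝ => (0, z.2)) (by fun_prop))).abs
      exact hcont.continuousAt.eventually_lt_const (by simpa using hκ)
  obtain ⟨ε, hε, hball⟩ := Metric.nhds_basis_closedBall.eventually_iff.1 hnear
  rw [Real.closedBall_eq_Icc, zero_sub, zero_add] at hball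
  refine ⟨ε, hε, fun t x hx y hy => ?_⟩
  obtain ⟨s, hs, hts⟩ := hDT.exists_mem_Ico₀ hT t
  refine (convex_Icc (-ε) ε).norm_image_sub_le_of_norm_hasDerivWithin_le
    (f := fun x => H x t - D t 0 * x) (f' := fun x => D t x - D t 0) (fun x _ => ?_)
    (fun x hx => ?_) hy hx
  · convert! ((differentiable_slice hH t x).hasDerivAt.sub
      ((hasDerivAt_id x).const_mul (D t 0))).hasDerivWithinAt using 1
    rw [mul_one]
  · rw [hts]
    exact (hball hx s (Ico_subset_Icc_self hs)).le

/-- The nonlinear part is frozen outside a small strip, so that solutions are global; a solution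
that is kept inside the strip by stability solves the original equation. -/
theorem lyapunovUnstable_zero_of_two_lt_linTrace (hH : ContDiff ℝ 1 fun z : ℝ × ℝ => H z.1 z.2)
    (hH₀ : ∀ t, H 0 t = 0) (hT : 0 < T) (hHT : ∀ x, Function.Periodic (H x) T)
    (htr : 2 < linTrace H (fun _ => 0) T) : LyapunovUnstable H fun _ => 0 := by
  intro hstable
  set q := linCoeff H fun _ => 0
  have hq : Continuous q := continuous_linCoeff hH continuous_const
  obtain ⟨κ, hκ, w, hw⟩ :=
    exists_unstable_direction hq hT (periodic_linCoeff hHT fun _ => rfl) htr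
  obtain ⟨ε, hε, hlip⟩ := exists_forall_abs_sub_linCoeff_mul_sub_le hH hT hHT hκ
  have hcont : Continuous (Function.uncurry fun x t => H x t - q t * x) :=
    hH.continuous.sub ((hq.comp continuous_snd).mul continuous_fst)
  obtain ⟨R, hR, hReq, hRlip⟩ :=
    exists_extension_of_lipschitz hcont (neg_le_self hε.le) hlip hκ.le
  have hR₀ : ∀ t, R 0 t = 0 := fun t => by simp [hReq t 0 ⟨by linarith, hε.le⟩, hH₀]
  have hHR : ∀ t, ∀ x ∈ Icc (-ε) ε, q t * x + R x t = H x t := fun t x hx => by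
    rw [hReq t x hx, add_sub_cancel]
  obtain ⟨δ, hδ, hδε⟩ := hstable ε hε
  obtain ⟨s, hsw, hs⟩ : ∃ s : ℝ, ‖s • w‖ < min δ ε ∧ s ≠ 0 := by
    have hsmall : Tendsto (fun s : ℝ => ‖s • w‖) (𝓝[≠] 0) (𝓝 0) :=
      ((by fun_prop : Continuous fun s : ℝ => ‖s • w‖).tendsto' 0 0 (by simp)).mono_left
        nhdsWithin_le_nhds
    exact ((hsmall.eventually_lt_const (lt_min hδ hε)).and self_mem_nhdsWithin).exists
  obtain ⟨u, v, hu₀, hv₀, huv⟩ := exists_isSolOn_univ_mul_add hq hR hRlip (s * w.1) (s * w.2)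
  have hinit : (u 0, v 0) = s • w := Prod.ext hu₀ hv₀
  obtain ⟨hu_init, hv_init⟩ : |u 0| < min δ ε ∧ |v 0| < min δ ε :=
    max_lt_iff.1 (hinit ▸ hsw : ‖(u 0, v 0)‖ < min δ ε)
  have hstay : ∀ t ≥ 0, (∀ r ∈ Icc 0 t, |u r| ≤ ε) → |u t| < ε ∧ |v t| < ε := fun t ht hle => by
    have hsol : IsSolOn H u v (Icc 0 t) := fun r hr =>
      hHR r _ (abs_le.1 (hle r hr)) ▸ huv.mono (subset_univ _) r hr
    simpa using hδε t ht u v hsol (by simpa using hu_init.trans_le (min_le_left _ _))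
      (by simpa using hv_init.trans_le (min_le_left _ _))
  have hu_lt : ∀ t ≥ 0, |u t| < ε := forall_lt_of_forall_le_imp_lt huv.continuous.abs
    (hu_init.trans_le (min_le_right _ _)) fun t ht hle => (hstay t ht hle).1
  obtain ⟨t, ht, hεt⟩ := hw huv (fun t _ => by simpa [hR₀] using hRlip t (u t) 0) s hs hinit ε
  exact hεt.not_gt (max_lt_iff.2 (hstay t ht fun r hr => (hu_lt r hr.1).le))

theorem LyapunovStable.sub {φ : ℝ → ℝ} (hφ : IsSol G φ) (h : LyapunovStable G φ) :
    LyapunovStable (fun u t => G (φ t + u) t - G (φ t) t) fun _ => 0 := by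
  intro ε hε
  obtain ⟨δ, hδ, hstable⟩ := h ε hε
  refine ⟨δ, hδ, fun T hT u v huv hu hv => ?_⟩
  have hsol : IsSolOn G (fun t => φ t + u t) (fun t => deriv φ t + v t) (Icc 0 T) := fun t ht => by
    have hφt := IsSolOn.mono hφ (subset_univ (Icc 0 T)) t ht
    refine ⟨hφt.1.add (huv t ht).1, ?_⟩
    convert! hφt.2.add (huv t ht).2 using 1
    ring
  simpa using hstable T hT _ _ hsol (by simpa using hu) (by simpa using hv)

theorem lyapunovUnstable_of_two_lt_linTrace (hG : ContDiff ℝ 1 fun z : ℝ × ℝ => G z.1 z.2)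
    (hT : 0 < T) (hGT : ∀ x, Function.Periodic (G x) T) {φ : ℝ → ℝ} (hφ : IsSol G φ)
    (hφT : Function.Periodic φ T) (htr : 2 < linTrace G φ T) : LyapunovUnstable G φ := by
  intro hstable
  have hφc : ContDiff ℝ 1 φ := contDiff_one_iff_deriv.2
    ⟨fun t => (IsSolOn.hasDerivAt hφ t).1.differentiableAt, hφ.continuous_velocity⟩
  refine lyapunovUnstable_zero_of_two_lt_linTrace ?_ (fun t => by simp) hT (fun u t => ?_) ?_
    (hstable.sub hφ)
  · exact (hG.comp (((hφc.comp contDiff_snd).add contDiff_fst).prodMk contDiff_snd)).sub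
      (hG.comp ((hφc.comp contDiff_snd).prodMk contDiff_snd))
  · simp only [hφT t, hGT _ t]
  · have hlin : linCoeff (fun u t => G (φ t + u) t - G (φ t) t) (fun _ => 0) = linCoeff G φ :=
      funext fun t => by
        rw [linCoeff, linCoeff, deriv_sub_const, deriv_comp_const_add (fun x => G x t), add_zero]
    rwa [linTrace, hlin]

/-- A trace below `-2` at `T` becomes a trace above `2` at the period `2 T`. -/
theorem lyapunovUnstable_of_isHyperbolic (hG : ContDiff ℝ 1 fun z : ℝ × ℝ => G z.1 z.2)
    (hT : 0 < T) (hGT : ∀ x, Function.Periodic (G x) T) {φ : ℝ → ℝ} (hφ : IsSol G φ)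
    (hφT : Function.Periodic φ T) (hhyp : IsHyperbolic G φ T) : LyapunovUnstable G φ := by
  have hq : Continuous (linCoeff G φ) := continuous_linCoeff hG hφ.continuous
  have htrace : linTrace G φ (2 * T) = linTrace G φ T ^ 2 - 2 := by
    rw [linTrace, two_mul, poincareMatrix_add_period hq (periodic_linCoeff hGT hφT),
      mul_self_fin_two, det_poincareMatrix hq, trace_sub, trace_smul, one_smul, trace_one]
    simp [linTrace, sq]
  have hsq : 2 ^ 2 < linTrace G φ T ^ 2 := sq_lt_sq.2 (by rwa [abs_two])
  have hG2T : ∀ x, Function.Periodic (G x) (2 * T) := fun x => by simpa using (hGT x).nat_mul 2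
  have hφ2T : Function.Periodic φ (2 * T) := by simpa using hφT.nat_mul 2
  exact lyapunovUnstable_of_two_lt_linTrace hG (by positivity) hG2T hφ hφ2T (by linarith)

end Instability

/-! ### Periodic families through an autonomous equation -/

theorem exists_forall_lt_of_derivWithin_neg {g : ℝ → ℝ} {a b c : ℝ} (hab : a < b) (hc : c < g a)
    (hg : derivWithin g (Ico a b) a < 0) :
    ∃ r ∈ Ioc a b, ∀ x ∈ Ioo a r, c < g x ∧ g x < g a := by
  have hderiv := (differentiableWithinAt_of_derivWithin_ne_zero hg.ne).hasDerivWithinAt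
  have hIoo : 𝓝[Ico a b \ {a}] a = 𝓝[>] a := by
    rw [Ico_sdiff_left, nhdsWithin_Ioo_eq_nhdsGT hab]
  have hslope : ∀ᶠ x in 𝓝[>] a, slope g a x < 0 :=
    hIoo ▸ (hasDerivWithinAt_iff_tendsto_slope.1 hderiv).eventually_lt_const hg
  have hgt : ∀ᶠ x in 𝓝[>] a, c < g x :=
    hIoo ▸ (hderiv.continuousWithinAt.mono sdiff_subset).eventually_const_lt hc
  obtain ⟨r, hr, hsub⟩ := (mem_nhdsGT_iff_exists_mem_Ioc_Ioo_subset hab).1 (hgt.and hslope)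
  refine ⟨r, hr, fun x hx => ⟨(hsub hx).1, ?_⟩⟩
  have hneg : slope g a x < 0 := (hsub hx).2
  rwa [slope_def_field, div_lt_iff₀ (sub_pos.2 hx.1), zero_mul, sub_neg] at hneg

theorem exists_forall_gt_of_derivWithin_pos {g : ℝ → ℝ} {a b : ℝ} (hab : a < b)
    (hg : 0 < derivWithin g (Ico a b) a) : ∃ r ∈ Ioc a b, ∀ x ∈ Ioo a r, g a < g x := by
  obtain ⟨r, hr, hlt⟩ := exists_forall_lt_of_derivWithin_neg (g := fun x => -g x) hab
    (sub_one_lt _) (by rwa [derivWithin.fun_neg, neg_lt_zero])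
  exact ⟨r, hr, fun x hx => neg_lt_neg_iff.1 (hlt x hx).2⟩

/-- A family `φ (·, e)`, `0 ≤ e < e₀`, of `T`-periodic solutions of `x'' + F (x, t, e) = 0`, with
forcing `T`-periodic in time, that starts at a nonconstant solution of an autonomous equation. -/
structure IsPeriodicFamily (F : ℝ → ℝ → ℝ → ℝ) (T e₀ : ℝ) (φ : ℝ → ℝ → ℝ) : Prop where
  pos : 0 < e₀
  period_pos : 0 < T
  contDiff : ∀ e ∈ Ico 0 e₀, ContDiff ℝ 1 fun z : ℝ × ℝ => F z.1 z.2 e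
  periodic_time : ∀ e ∈ Ico 0 e₀, ∀ x, Function.Periodic (fun t => F x t e) T
  autonomous : ∀ x t, F x t 0 = F x 0 0
  sol : ∀ e ∈ Ico 0 e₀, IsSol (fun x t => F x t e) fun t => φ t e
  periodic : ∀ e ∈ Ico 0 e₀, Function.Periodic (fun t => φ t e) T
  nonconstant : ∃ t, deriv (fun t => φ t 0) t ≠ 0

namespace IsPeriodicFamily

variable {F : ℝ → ℝ → ℝ → ℝ} {T e₀ : ℝ} {φ : ℝ → ℝ → ℝ}

theorem linTrace_zero (hφ : IsPeriodicFamily F T e₀ φ) :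
    linTrace (fun x t => F x t 0) (fun t => φ t 0) T = 2 := by
  have h₀ : (0 : ℝ) ∈ Ico 0 e₀ := left_mem_Ico.2 hφ.pos
  have hF : (fun x t => F x t 0) = fun x _ => F x 0 0 := funext₂ hφ.autonomous
  have hf : ContDiff ℝ 1 fun x => F x 0 0 :=
    (hφ.contDiff 0 h₀).comp (contDiff_id.prodMk contDiff_const)
  obtain ⟨t₀, ht₀⟩ := hφ.nonconstant
  rw [hF]
  exact linTrace_autonomous hf (hF ▸ hφ.sol 0 h₀) (hφ.periodic 0 h₀) ht₀

theorem linearizedStable (hφ : IsPeriodicFamily F T e₀ φ) {e : ℝ} (he : e ∈ Ico 0 e₀)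
    (hell : IsElliptic (fun x t => F x t e) (fun t => φ t e) T) :
    LinearizedStable (fun x t => F x t e) fun t => φ t e :=
  linearizedStable_of_isElliptic (hφ.contDiff e he) (hφ.sol e he).continuous hφ.period_pos
    (hφ.periodic_time e he) (hφ.periodic e he) hell

theorem lyapunovUnstable (hφ : IsPeriodicFamily F T e₀ φ) {e : ℝ} (he : e ∈ Ico 0 e₀)
    (hhyp : IsHyperbolic (fun x t => F x t e) (fun t => φ t e) T) :
    LyapunovUnstable (fun x t => F x t e) fun t => φ t e :=
  lyapunovUnstable_of_isHyperbolic (hφ.contDiff e he) hφ.period_pos (hφ.periodic_time e he)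
    (hφ.sol e he) (hφ.periodic e he) hhyp

end IsPeriodicFamily

theorem IsAdmissible.contDiff_slice {F : ℝ → ℝ → ℝ → ℝ} {f : ℝ → ℝ} (hF : IsAdmissible F f)
    (e : ℝ) : ContDiff ℝ 1 fun z : ℝ × ℝ => F z.1 z.2 e :=
  (hF.smooth.of_le (by norm_num)).comp
    (contDiff_fst.prodMk (contDiff_snd.prodMk contDiff_const))

theorem IsAdmissible.periodic {F : ℝ → ℝ → ℝ → ℝ} {f : ℝ → ℝ} (hF : IsAdmissible F f)
    (m : ℕ) (x e : ℝ) :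
    Function.Periodic (fun t => F x t e) (2 * (m * Real.pi)) := by
  have hper : Function.Periodic (fun t => F x t e) (2 * Real.pi) :=
    fun t => hF.periodic_time x t e
  simpa only [mul_left_comm] using hper.nat_mul m

theorem IsOddFamily.isPeriodicFamily {F : ℝ → ℝ → ℝ → ℝ} {f : ℝ → ℝ} (hF : IsAdmissible F f)
    {m : ℕ} (hm : 0 < m) {h e₀ : ℝ} (hh : 0 < h) {η : ℝ → ℝ} {φ : ℝ → ℝ → ℝ}
    (hφ : IsOddFamily F m h e₀ η φ) : IsPeriodicFamily F (2 * m * Real.pi) e₀ φ where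
  pos := hφ.pos
  period_pos := by positivity
  contDiff e _ := hF.contDiff_slice e
  periodic_time e _ x := mul_assoc 2 (m : ℝ) Real.pi ▸ hF.periodic m x e
  autonomous x t := (hF.autonomous x t).trans (hF.autonomous x 0).symm
  sol := hφ.sol
  periodic e he := mul_assoc 2 (m : ℝ) Real.pi ▸
    (hφ.sol e he).periodic (hF.contDiff_slice e) (fun x t => hF.odd x t e)
      (fun x t => hF.even_time x t e) (fun x => hF.periodic m x e)
      (hφ.init_pos e he) (hφ.dirichlet e he)
  nonconstant := by
    have h₀ : (0 : ℝ) ∈ Ico 0 e₀ := left_mem_Ico.2 hφ.pos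
    refine ⟨0, ?_⟩
    rw [hφ.init_vel 0 h₀, hφ.start]
    positivity

end NewtonEq

open NewtonEq in
theorem corollary3p3_general {F : ℝ → ℝ → ℝ → ℝ} {T e₀ : ℝ} {φ : ℝ → ℝ → ℝ}
    (hφ : IsPeriodicFamily F T e₀ φ) :
    (derivWithin (fun e => linTrace (fun x t => F x t e) (fun t => φ t e) T) (Ico 0 e₀) 0 < 0 →
      ∃ e₁ ∈ Ioc 0 e₀, ∀ e ∈ Ioo 0 e₁,
        IsElliptic (fun x t => F x t e) (fun t => φ t e) T ∧
        LinearizedStable (fun x t => F x t e) (fun t => φ t e)) ∧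
    (0 < derivWithin (fun e => linTrace (fun x t => F x t e) (fun t => φ t e) T) (Ico 0 e₀) 0 →
      ∃ e₁ ∈ Ioc 0 e₀, ∀ e ∈ Ioo 0 e₁,
        IsHyperbolic (fun x t => F x t e) (fun t => φ t e) T ∧
        LyapunovUnstable (fun x t => F x t e) (fun t => φ t e)) := by
  have h₀ := hφ.linTrace_zero
  have hmem : ∀ {e e₁ : ℝ}, e₁ ∈ Ioc 0 e₀ → e ∈ Ioo 0 e₁ → e ∈ Ico 0 e₀ :=
    fun he₁ he => ⟨he.1.le, he.2.trans_le he₁.2⟩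
  refine ⟨fun hneg => ?_, fun hpos => ?_⟩
  · obtain ⟨e₁, he₁, hlt⟩ :=
      exists_forall_lt_of_derivWithin_neg (c := -2) hφ.pos (by rw [h₀]; norm_num) hneg
    refine ⟨e₁, he₁, fun e he => ?_⟩
    have hell : IsElliptic (fun x t => F x t e) (fun t => φ t e) T := abs_lt.2 (h₀ ▸ hlt e he)
    exact ⟨hell, hφ.linearizedStable (hmem he₁ he) hell⟩
  · obtain ⟨e₁, he₁, hgt⟩ := exists_forall_gt_of_derivWithin_pos hφ.pos hpos
    refine ⟨e₁, he₁, fun e he => ?_⟩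
    have hhyp : IsHyperbolic (fun x t => F x t e) (fun t => φ t e) T :=
      lt_abs.2 (Or.inl (h₀ ▸ hgt e he))
    exact ⟨hhyp, hφ.lyapunovUnstable (hmem he₁ he) hhyp⟩

theorem corollary3p3 (F : ℝ → ℝ → ℝ → ℝ) (f : ℝ → ℝ) (hF : NewtonEq.IsAdmissible F f)
    (m p : ℕ) (hm : 0 < m) (hp : 0 < p)
    (h : ℝ) (h_pos : 0 < h) (h_lt : ∃ x : ℝ, h < NewtonEq.potential f x)
    (h_period : NewtonEq.periodFn f h = 2 * m * Real.pi / p)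
    (h_nondeg : deriv (NewtonEq.periodFn f) h ≠ 0)
    (e₀ : ℝ) (η : ℝ → ℝ) (φ : ℝ → ℝ → ℝ) (hφ : NewtonEq.IsOddFamily F m h e₀ η φ) :
    (derivWithin (NewtonEq.familyTrace F m φ) (Set.Ico 0 e₀) 0 < 0 →
      ∃ e₁ ∈ Set.Ioc 0 e₀, ∀ e ∈ Set.Ioo 0 e₁,
        NewtonEq.IsElliptic (fun x t => F x t e) (fun t => φ t e) (2 * m * Real.pi) ∧
        NewtonEq.LinearizedStable (fun x t => F x t e) (fun t => φ t e)) ∧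
    (0 < derivWithin (NewtonEq.familyTrace F m φ) (Set.Ico 0 e₀) 0 →
      ∃ e₁ ∈ Set.Ioc 0 e₀, ∀ e ∈ Set.Ioo 0 e₁,
        NewtonEq.IsHyperbolic (fun x t => F x t e) (fun t => φ t e) (2 * m * Real.pi) ∧
        NewtonEq.LyapunovUnstable (fun x t => F x t e) (fun t => φ t e)) :=
  corollary3p3_general (hφ.isPeriodicFamily hF hm h_pos)
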